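/- Let $\Gamma=(V,E,s,r)$ be a directed graph: $V$ and $E$ are arbitrary sets (of vertices and edges) and $s,r:E\to V$ are the source and range maps. For $v,w\in V$ write $v\trianglerighteq w$ if there is a (possibly trivial) directed path from $v$ to $w$. A vertex $v$ is called forked if there are distinct edges $e,f\in s^{-1}(v)$ such that (i) $r(g)\not\trianglerighteq r(e)$ for all $g\in s^{-1}(v)\setminus\{e\}$, and (ii) $r(g)\not\trianglerighteq r(f)$ for all $g\in s^{-1}(v)\setminus\{f\}$. The graph inverse semigroup $\mathrm{Inv}(\Gamma)$ is the semigroup with zero generated by $V$, $E$ and $E^*=\{e^*: e\in E\}$ subject to the relations, for all $u,v\in V$ and $e,f\in E$: $uv=\delta_{u,v}u$; $s(e)e=e\,r(e)=e$; $r(e)e^*=e^*s(e)=e^*$; $f^*e=\delta_{f,e}\,r(e)$ (where $\delta$ is the Kronecker delta). Let $\mathscr{C}(\mathrm{Inv}(\Gamma))$ be the lattice of all semigroup congruences on $\mathrm{Inv}(\Gamma)$, ordered by inclusion. If $\Gamma$ has no forked vertices, then $\mathscr{C}(\mathrm{Inv}(\Gamma))$ is modular, that is, $a\le c$ implies $a\vee(b\wedge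 c)=(a\vee b)\wedge c$ for all $a,b,c\in\mathscr{C}(\mathrm{Inv}(\Gamma))$. -/

import Mathlib

universe u v

/-- A directed graph `Γ = (V, E, s, r)`: sets `V` of vertices and `E` of edges (loops, parallel
edges and infinite sets are allowed) with a source map `s` and a range map `r`. -/
structure DirectedGraph (V : Type u) (E : Type v) where
  /-- the source of an edge -/
  s : E → V
  /-- the range of an edge -/
  r : E → V

namespace DirectedGraph

/-- `Γ.Reaches x y`: there is a (possibly trivial) path from `x` to `y`, that is, a finite sequence
of consecutive edges leading from `x` to `y`. -/
def Reaches {V : Type u} {E : Type v} (Γ : DirectedGraph V E) : V → V → Prop :=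
  Relation.ReflTransGen (fun x y => ∃ e : E, Γ.s e = x ∧ Γ.r e = y)

/-- `x` is a forked vertex: there are distinct edges `e`, `f` with source `x` such that no edge
`g ≠ e` with source `x` has a path from `r(g)` to `r(e)`, and no edge `g ≠ f` with source `x` has
a path from `r(g)` to `r(f)`. -/
def IsForked {V : Type u} {E : Type v} (Γ : DirectedGraph V E) (x : V) : Prop :=
  ∃ e f : E, Γ.s e = x ∧ Γ.s f = x ∧ e ≠ f ∧
    (∀ g : E, Γ.s g = x → g ≠ e → ¬ Γ.Reaches (Γ.r g) (Γ.r e)) ∧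
    (∀ g : E, Γ.s g = x → g ≠ f → ¬ Γ.Reaches (Γ.r g) (Γ.r f))

/-- The generators of the graph inverse semigroup: `V`, `E` and `E* = {e* : e ∈ E}`. -/
inductive Gen (V : Type u) (E : Type v) : Type (max u v)
  | vertex (x : V) : Gen V E
  | edge (e : E) : Gen V E
  | star (e : E) : Gen V E

/-- The free semigroup with zero on the generators. -/
abbrev FreeWord (V : Type u) (E : Type v) : Type (max u v) := WithZero (FreeSemigroup (Gen V E))

namespace FreeWord

/-- The vertex `x` as an element of the free semigroup with zero. -/
def vertex {V : Type u} (E : Type v) (x : V) : FreeWord V E :=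
  ((FreeSemigroup.of (Gen.vertex x) : FreeSemigroup (Gen V E)) : FreeWord V E)

/-- The edge `e` as an element of the free semigroup with zero. -/
def edge (V : Type u) {E : Type v} (e : E) : FreeWord V E :=
  ((FreeSemigroup.of (Gen.edge e) : FreeSemigroup (Gen V E)) : FreeWord V E)

/-- The symbol `e*` as an element of the free semigroup with zero. -/
def star (V : Type u) {E : Type v} (e : E) : FreeWord V E :=
  ((FreeSemigroup.of (Gen.star e) : FreeSemigroup (Gen V E)) : FreeWord V E)

end FreeWord

open FreeWord in
/-- The defining relations of the graph inverse semigroup: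
(GI1) `x y = δ_{x,y} x`, (GI2) `s(e) e = e r(e) = e`, (GI3) `r(e) e* = e* s(e) = e*`,
(CK1) `f* e = δ_{f,e} r(e)`. -/
inductive Rel {V : Type u} {E : Type v} (Γ : DirectedGraph V E) :
    FreeWord V E → FreeWord V E → Prop
  | vertex_self (x : V) : Rel Γ (vertex E x * vertex E x) (vertex E x)
  | vertex_ne (x y : V) (h : x ≠ y) : Rel Γ (vertex E x * vertex E y) 0
  | source_edge (e : E) : Rel Γ (vertex E (Γ.s e) * edge V e) (edge V e)
  | edge_range (e : E) : Rel Γ (edge V e * vertex E (Γ.r e)) (edge V e)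
  | range_star (e : E) : Rel Γ (vertex E (Γ.r e) * star V e) (star V e)
  | star_source (e : E) : Rel Γ (star V e * vertex E (Γ.s e)) (star V e)
  | star_edge_self (e : E) : Rel Γ (star V e * edge V e) (vertex E (Γ.r e))
  | star_edge_ne (f e : E) (h : f ≠ e) : Rel Γ (star V f * edge V e) 0

/-- The graph inverse semigroup `Inv(Γ)`: the semigroup with zero generated by `V ∪ E ∪ E*` subject
to (GI1), (GI2), (GI3) and (CK1). -/
def InvSemigroup {V : Type u} {E : Type v} (Γ : DirectedGraph V E) : Type (max u v) :=
  (conGen Γ.Rel).Quotient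

instance {V : Type u} {E : Type v} (Γ : DirectedGraph V E) : SemigroupWithZero Γ.InvSemigroup where
  toSemigroup := inferInstanceAs (Semigroup (conGen Γ.Rel).Quotient)
  zero := ((0 : FreeWord V E) : (conGen Γ.Rel).Quotient)
  zero_mul a := Con.induction_on a fun w =>
    congrArg (fun z : FreeWord V E => (z : (conGen Γ.Rel).Quotient)) (zero_mul w)
  mul_zero a := Con.induction_on a fun w =>
    congrArg (fun z : FreeWord V E => (z : (conGen Γ.Rel).Quotient)) (mul_zero w)

/-- The lattice `𝒞(Inv(Γ))` of all semigroup congruences on `Inv(Γ)`, ordered by inclusion. -/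
abbrev CongruenceLattice {V : Type u} {E : Type v} (Γ : DirectedGraph V E) : Type (max u v) :=
  Con Γ.InvSemigroup

end DirectedGraph

namespace DirectedGraph

/-! Every element of Inv(Γ) is 0 or p q* for paths p, q with a common range, and a congruence is
determined by three kinds of basic pairs: vertices congruent to 0, edges with e e* ≡ s(e) (tight
edges), and closed paths congruent to their base vertex (`Covers.le`). So for x ≤ z the inequality
(x ⊔ y) ⊓ z ≤ x ⊔ (y ⊓ z) need only be checked on basic pairs.

Two facts make this possible. If e is tight, the ranges of all other edges at s(e) are congruent to
0; and tight paths from a nonzero vertex are prefixes of one another.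

Zero vertices: a ≡ 0 in x ⊔ y has a derivation along tight edges of x and y (`joinZero_of_sup`). If
also a ≡ 0 in z, every vertex in it is zero in z, so each use of y is a use of y ⊓ z.

Tight edges: where s(e) is nonzero in x ⊔ y, tightness in x ⊔ y comes from x or from y
(`sup_cong_edge`). Where s(e) is zero in x ⊔ y but not in z, a failure would exhibit s(e) as a
forked vertex (`JoinZero.cong_edge`), the only use of the hypothesis.

Closed paths: where the base is zero in x ⊔ y but not in z, it is already zero in y
(`JoinZero.zero_of_closed`). Where it is nonzero in x ⊔ y, the tight closed paths there are
determined by their lengths, the signed lengths of trivial ones form a subgroup of ℤ, and the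
subgroup of x ⊔ y is the sum of those of x and y (`exists_closedLength_of_sup`); modularity is then
inherited from ℤ. -/

variable {V : Type u} {E : Type v} {Γ : DirectedGraph V E}

/-! ### Generators of the graph inverse semigroup -/

/-- The class in `Inv(Γ)` of an element of the free semigroup with zero. -/
def ofWord (Γ : DirectedGraph V E) (z : FreeWord V E) : Γ.InvSemigroup :=
  (z : (conGen Γ.Rel).Quotient)

/-- The vertex `a` as an element of `Inv(Γ)`. -/
def vert (Γ : DirectedGraph V E) (a : V) : Γ.InvSemigroup :=
  Γ.ofWord (FreeWord.vertex E a)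

/-- The edge `e` as an element of `Inv(Γ)`. -/
def arc (Γ : DirectedGraph V E) (e : E) : Γ.InvSemigroup :=
  Γ.ofWord (FreeWord.edge V e)

/-- The symbol `e*` as an element of `Inv(Γ)`. -/
def arcStar (Γ : DirectedGraph V E) (e : E) : Γ.InvSemigroup :=
  Γ.ofWord (FreeWord.star V e)

theorem coe_eq_of_rel {a b : FreeWord V E} (h : Γ.Rel a b) :
    Γ.ofWord a = Γ.ofWord b :=
  (Con.eq _).2 (ConGen.Rel.of _ _ h)

theorem vert_mul_self (a : V) : Γ.vert a * Γ.vert a = Γ.vert a :=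
  coe_eq_of_rel (.vertex_self a)

theorem vert_mul_ne {a b : V} (h : a ≠ b) : Γ.vert a * Γ.vert b = 0 :=
  coe_eq_of_rel (.vertex_ne a b h)

theorem vert_mul_arc (e : E) : Γ.vert (Γ.s e) * Γ.arc e = Γ.arc e :=
  coe_eq_of_rel (.source_edge e)

theorem arc_mul_vert (e : E) : Γ.arc e * Γ.vert (Γ.r e) = Γ.arc e :=
  coe_eq_of_rel (.edge_range e)

theorem vert_mul_arcStar (e : E) : Γ.vert (Γ.r e) * Γ.arcStar e = Γ.arcStar e :=
  coe_eq_of_rel (.range_star e)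

theorem arcStar_mul_vert (e : E) : Γ.arcStar e * Γ.vert (Γ.s e) = Γ.arcStar e :=
  coe_eq_of_rel (.star_source e)

theorem arcStar_mul_arc (e : E) : Γ.arcStar e * Γ.arc e = Γ.vert (Γ.r e) :=
  coe_eq_of_rel (.star_edge_self e)

theorem arcStar_mul_arc_ne {f e : E} (h : f ≠ e) : Γ.arcStar f * Γ.arc e = 0 :=
  coe_eq_of_rel (.star_edge_ne f e h)

/-! ### Paths -/

/-- `Γ.IsPath a l b`: the list `l` of consecutive edges is a path from `a` to `b`. -/
inductive IsPath (Γ : DirectedGraph V E) : V → List E → V → Prop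
  | nil (a : V) : IsPath Γ a [] a
  | cons (e : E) {l : List E} {b : V} (h : IsPath Γ (Γ.r e) l b) : IsPath Γ (Γ.s e) (e :: l) b

theorem IsPath.eq_of_nil {a b : V} (h : Γ.IsPath a [] b) : a = b := by
  cases h; rfl

theorem IsPath.of_cons {a b : V} {e : E} {l : List E} (h : Γ.IsPath a (e :: l) b) :
    a = Γ.s e ∧ Γ.IsPath (Γ.r e) l b := by
  cases h with
  | cons e h => exact ⟨rfl, h⟩

theorem IsPath.append {a b c : V} {l m : List E} (hl : Γ.IsPath a l b) (hm : Γ.IsPath b m c) :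
    Γ.IsPath a (l ++ m) c := by
  induction hl with
  | nil a => exact hm
  | cons e h ih => exact .cons e (ih hm)

theorem IsPath.singleton (e : E) : Γ.IsPath (Γ.s e) [e] (Γ.r e) := .cons e (.nil _)

theorem Reaches.exists_isPath {a b : V} (h : Γ.Reaches a b) : ∃ l, Γ.IsPath a l b := by
  induction h with
  | refl => exact ⟨[], .nil a⟩
  | tail _ h ih =>
    obtain ⟨e, rfl, rfl⟩ := h
    obtain ⟨l, hl⟩ := ih
    exact ⟨_, hl.append (.singleton e)⟩

/-- The product of the edges of a path `l` ending at `b`. -/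
def path (Γ : DirectedGraph V E) : List E → V → Γ.InvSemigroup
  | [], b => Γ.vert b
  | e :: l, b => Γ.arc e * path Γ l b

/-- The element `l*` of `Inv(Γ)` for a path `l` ending at `b`. -/
def pathStar (Γ : DirectedGraph V E) : List E → V → Γ.InvSemigroup
  | [], b => Γ.vert b
  | e :: l, b => pathStar Γ l b * Γ.arcStar e

/-- The element `p q*` of `Inv(Γ)` for paths `p` and `q` ending at `b`. -/
def pathMulStar (Γ : DirectedGraph V E) (p q : List E) (b : V) : Γ.InvSemigroup :=
  Γ.path p b * Γ.pathStar q b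

theorem IsPath.vert_mul_path {a b : V} {l : List E} (h : Γ.IsPath a l b) :
    Γ.vert a * Γ.path l b = Γ.path l b := by
  cases h with
  | nil => exact vert_mul_self _
  | cons e h => rw [path, ← mul_assoc, vert_mul_arc]

theorem IsPath.pathStar_mul_vert {a b : V} {l : List E} (h : Γ.IsPath a l b) :
    Γ.pathStar l b * Γ.vert a = Γ.pathStar l b := by
  cases h with
  | nil => exact vert_mul_self _
  | cons e h => rw [pathStar, mul_assoc, arcStar_mul_vert]

theorem path_mul_vert (l : List E) (b : V) : Γ.path l b * Γ.vert b = Γ.path l b := by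
  induction l with
  | nil => exact vert_mul_self _
  | cons e l ih => rw [path, mul_assoc, ih]

theorem vert_mul_pathStar (l : List E) (b : V) :
    Γ.vert b * Γ.pathStar l b = Γ.pathStar l b := by
  induction l with
  | nil => exact vert_mul_self _
  | cons e l ih => rw [pathStar, ← mul_assoc, ih]

theorem IsPath.path_mul_path (l : List E) {m : List E} {b c : V} (h : Γ.IsPath b m c) :
    Γ.path l b * Γ.path m c = Γ.path (l ++ m) c := by
  induction l with
  | nil => exact h.vert_mul_path
  | cons e l ih => rw [path, mul_assoc, ih]; rfl

theorem IsPath.pathStar_mul_pathStar (l : List E) {m : List E} {b c : V} (h : Γ.IsPath b m c) :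
    Γ.pathStar m c * Γ.pathStar l b = Γ.pathStar (l ++ m) c := by
  induction l with
  | nil => exact h.pathStar_mul_vert
  | cons e l ih => rw [pathStar, ← mul_assoc, ih]; rfl

theorem IsPath.pathStar_mul_path {a b : V} {l : List E} (h : Γ.IsPath a l b) :
    Γ.pathStar l b * Γ.path l b = Γ.vert b := by
  induction h with
  | nil => exact vert_mul_self _
  | cons e h ih =>
    rw [path, pathStar, mul_assoc, ← mul_assoc (Γ.arcStar e), arcStar_mul_arc, h.vert_mul_path, ih]

theorem IsPath.pathStar_mul_path_append {a b c : V} {l m : List E} (hl : Γ.IsPath a l b)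
    (hm : Γ.IsPath b m c) : Γ.pathStar l b * Γ.path (l ++ m) c = Γ.path m c := by
  rw [← hm.path_mul_path, ← mul_assoc, hl.pathStar_mul_path, hm.vert_mul_path]

theorem IsPath.pathStar_append_mul_path {a b c : V} {l m : List E} (hl : Γ.IsPath a l b)
    (hm : Γ.IsPath b m c) : Γ.pathStar (l ++ m) c * Γ.path l b = Γ.pathStar m c := by
  rw [← hm.pathStar_mul_pathStar, mul_assoc, hl.pathStar_mul_path, hm.pathStar_mul_vert]

/-- At the first place where the two paths diverge, f* e = 0 annihilates the product. -/
theorem IsPath.comparable {a b a' b' : V} {l m : List E} (hl : Γ.IsPath a l b)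
    (hm : Γ.IsPath a' m b') : Γ.pathStar l b * Γ.path m b' = 0 ∨ a = a' ∧
      ((∃ k, m = l ++ k ∧ Γ.IsPath b k b') ∨ ∃ k, l = m ++ k ∧ Γ.IsPath b' k b) := by
  by_cases haa : a = a'
  swap
  · left
    rw [← hl.pathStar_mul_vert, ← hm.vert_mul_path, mul_assoc, ← mul_assoc (Γ.vert a),
      vert_mul_ne haa, zero_mul, mul_zero]
  subst haa
  induction hl generalizing m with
  | nil a => exact .inr ⟨rfl, .inl ⟨m, rfl, hm⟩⟩
  | @cons e l b h ih =>
    cases m with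
    | nil =>
      obtain rfl := hm.eq_of_nil
      exact .inr ⟨rfl, .inr ⟨_, rfl, .cons e h⟩⟩
    | cons f m =>
      by_cases hef : e = f
      · subst hef
        obtain ⟨_, hm⟩ := hm.of_cons
        rcases ih hm with h0 | ⟨_, ⟨k, rfl, hk⟩ | ⟨k, rfl, hk⟩⟩
        · left
          rw [path, pathStar, mul_assoc, ← mul_assoc (Γ.arcStar e), arcStar_mul_arc,
            hm.vert_mul_path, h0]
        · exact .inr ⟨rfl, .inl ⟨k, rfl, hk⟩⟩
        · exact .inr ⟨rfl, .inr ⟨k, rfl, hk⟩⟩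
      · left
        rw [path, pathStar, mul_assoc, ← mul_assoc (Γ.arcStar e), arcStar_mul_arc_ne hef, zero_mul,
          mul_zero]

/-! ### Normal forms -/

/-- `w` is zero or of the form `p q*` for paths `p`, `q` with the same range. -/
def HasNormalForm (w : Γ.InvSemigroup) : Prop :=
  w = 0 ∨ ∃ p q a b c, Γ.IsPath a p c ∧ Γ.IsPath b q c ∧ w = Γ.pathMulStar p q c

theorem hasNormalForm_pathMulStar {p q : List E} {a b c : V} (hp : Γ.IsPath a p c)
    (hq : Γ.IsPath b q c) : HasNormalForm (Γ.pathMulStar p q c) :=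
  .inr ⟨p, q, a, b, c, hp, hq, rfl⟩

theorem hasNormalForm_vert_mul (d : V) {w : Γ.InvSemigroup} (hw : HasNormalForm w) :
    HasNormalForm (Γ.vert d * w) := by
  rcases hw with rfl | ⟨p, q, a, b, c, hp, hq, rfl⟩
  · exact .inl (mul_zero _)
  by_cases h : d = a
  · subst h
    rw [pathMulStar, ← mul_assoc, hp.vert_mul_path]
    exact hasNormalForm_pathMulStar hp hq
  · left
    rw [pathMulStar, ← mul_assoc, ← hp.vert_mul_path, ← mul_assoc, vert_mul_ne h, zero_mul,
      zero_mul]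

theorem hasNormalForm_arc_mul (e : E) {w : Γ.InvSemigroup} (hw : HasNormalForm w) :
    HasNormalForm (Γ.arc e * w) := by
  rcases hw with rfl | ⟨p, q, a, b, c, hp, hq, rfl⟩
  · exact .inl (mul_zero _)
  by_cases h : Γ.r e = a
  · subst h
    rw [pathMulStar, ← mul_assoc]
    exact hasNormalForm_pathMulStar (.cons e hp) hq
  · left
    rw [pathMulStar, ← mul_assoc, ← hp.vert_mul_path, ← arc_mul_vert, mul_assoc (Γ.arc e),
      ← mul_assoc (Γ.vert _) (Γ.vert _), vert_mul_ne h, zero_mul, mul_zero, zero_mul]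

theorem hasNormalForm_arcStar_mul (e : E) {w : Γ.InvSemigroup} (hw : HasNormalForm w) :
    HasNormalForm (Γ.arcStar e * w) := by
  rcases hw with rfl | ⟨p, q, a, b, c, hp, hq, rfl⟩
  · exact .inl (mul_zero _)
  have he : Γ.pathStar [e] (Γ.r e) = Γ.arcStar e := vert_mul_arcStar e
  rcases (IsPath.singleton e).comparable hp with h0 | ⟨rfl, ⟨k, rfl, hk⟩ | ⟨k, hpk, hk⟩⟩
  · left
    rw [pathMulStar, ← mul_assoc, ← he, h0, zero_mul]
  · rw [pathMulStar, ← mul_assoc, ← he, (IsPath.singleton e).pathStar_mul_path_append hk]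
    exact hasNormalForm_pathMulStar hk hq
  · rw [pathMulStar, ← mul_assoc, ← he, hpk, hp.pathStar_append_mul_path hk,
      hk.pathStar_mul_pathStar, ← vert_mul_pathStar]
    exact hasNormalForm_pathMulStar (.nil _) (hq.append hk)

/-- Left multiplication by a generator preserves normal forms. Uniqueness is never needed: later
arguments compare normal forms only up to a congruence. -/
theorem hasNormalForm (w : Γ.InvSemigroup) : HasNormalForm w := by
  have hgen : ∀ (g : Gen V E) (w : Γ.InvSemigroup), HasNormalForm w →
      HasNormalForm (Γ.ofWord (FreeSemigroup.of g : FreeSemigroup (Gen V E)) * w) := by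
    rintro (a | e | e) w hw
    exacts [hasNormalForm_vert_mul a hw, hasNormalForm_arc_mul e hw, hasNormalForm_arcStar_mul e hw]
  have hvert : ∀ a : V, HasNormalForm (Γ.vert a) := fun a => by
    have := hasNormalForm_pathMulStar (.nil a) (.nil a) (Γ := Γ)
    rwa [pathMulStar, path, pathStar, vert_mul_self] at this
  refine Con.induction_on (C := HasNormalForm (Γ := Γ)) w fun z => ?_
  induction z using WithZero.recZeroCoe with
  | zero => exact .inl rfl
  | coe z =>
    induction z using FreeSemigroup.recOnMul with
    | ih1 g =>
      rcases g with a | e | e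
      · exact hvert a
      · have := hasNormalForm_arc_mul e (hvert (Γ.r e))
        rwa [arc_mul_vert] at this
      · have := hasNormalForm_arcStar_mul e (hvert (Γ.s e))
        rwa [arcStar_mul_vert] at this
    | ih2 g z _ ih => exact hgen g _ ih

/-! ### Congruences -/

theorem IsPath.cong_zero {x : Con Γ.InvSemigroup} {a b : V} {l : List E} (h : Γ.IsPath a l b)
    (ha : x (Γ.vert a) 0) : x (Γ.vert b) 0 := by
  have := x.mul (x.mul (x.refl (Γ.pathStar l b)) ha) (x.refl (Γ.path l b))
  rwa [mul_zero, zero_mul, h.pathStar_mul_vert, h.pathStar_mul_path] at this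

theorem cong_pathMulStar_zero {x : Con Γ.InvSemigroup} {b : V} (p q : List E)
    (hb : x (Γ.vert b) 0) : x (Γ.pathMulStar p q b) 0 := by
  have := x.mul (x.mul (x.refl (Γ.path p b)) hb) (x.refl (Γ.pathStar q b))
  rwa [mul_zero, zero_mul, path_mul_vert] at this

theorem cong_vert_zero {x : Con Γ.InvSemigroup} {a b c : V} {p q : List E} (hp : Γ.IsPath a p c)
    (hq : Γ.IsPath b q c) (h : x (Γ.pathMulStar p q c) 0) : x (Γ.vert c) 0 := by
  have := x.mul (x.mul (x.refl (Γ.pathStar p c)) h) (x.refl (Γ.path q c))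
  rwa [mul_zero, zero_mul, pathMulStar, ← mul_assoc, hp.pathStar_mul_path, vert_mul_pathStar,
    hq.pathStar_mul_path] at this

/-- Each edge `e` of `l` satisfies `e e* ≡ s(e)`. -/
def Tight (x : Con Γ.InvSemigroup) (l : List E) : Prop :=
  ∀ e ∈ l, x (Γ.arc e * Γ.arcStar e) (Γ.vert (Γ.s e))

theorem tight_nil (x : Con Γ.InvSemigroup) : Tight x [] := by simp [Tight]

theorem tight_cons {x : Con Γ.InvSemigroup} {e : E} {l : List E} :
    Tight x (e :: l) ↔ x (Γ.arc e * Γ.arcStar e) (Γ.vert (Γ.s e)) ∧ Tight x l := by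
  simp [Tight]

theorem tight_append {x : Con Γ.InvSemigroup} {l m : List E} :
    Tight x (l ++ m) ↔ Tight x l ∧ Tight x m := by
  simp [Tight, or_imp, forall_and]

theorem Tight.mono {x y : Con Γ.InvSemigroup} (hxy : x ≤ y) {l : List E} (h : Tight x l) :
    Tight y l := fun e he => hxy (h e he)

theorem IsPath.tight_iff {x : Con Γ.InvSemigroup} {a b : V} {l : List E} (h : Γ.IsPath a l b) :
    Tight x l ↔ x (Γ.pathMulStar l l b) (Γ.vert a) := by
  induction h with
  | nil a =>
    have : Γ.pathMulStar [] [] a = Γ.vert a := vert_mul_self a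
    exact iff_of_true (tight_nil x) (this ▸ x.refl _)
  | @cons e l b h ih =>
    have hs : Γ.pathMulStar (e :: l) (e :: l) b =
        Γ.arc e * Γ.pathMulStar l l b * Γ.arcStar e := by
      simp only [pathMulStar, path, pathStar, mul_assoc]
    have hm : Γ.vert (Γ.r e) * Γ.pathMulStar l l b = Γ.pathMulStar l l b := by
      rw [pathMulStar, ← mul_assoc, h.vert_mul_path]
    have hm' : Γ.pathMulStar l l b * Γ.vert (Γ.r e) = Γ.pathMulStar l l b := by
      rw [pathMulStar, mul_assoc, h.pathStar_mul_vert]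
    rw [tight_cons, ih, hs]
    constructor
    · rintro ⟨h1, h2⟩
      refine x.trans (x.mul (x.mul (x.refl (Γ.arc e)) h2) (x.refl (Γ.arcStar e))) ?_
      rwa [arc_mul_vert]
    · intro h1
      constructor
      · have h2 := x.mul (x.refl (Γ.arc e * Γ.arcStar e)) h1
        have h3 : Γ.arc e * Γ.arcStar e * (Γ.arc e * Γ.pathMulStar l l b * Γ.arcStar e) =
            Γ.arc e * Γ.pathMulStar l l b * Γ.arcStar e := by
          rw [mul_assoc (Γ.arc e), ← mul_assoc (Γ.arcStar e), ← mul_assoc (Γ.arcStar e),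
            arcStar_mul_arc, hm, mul_assoc (Γ.arc e)]
        rw [h3, mul_assoc (Γ.arc e) (Γ.arcStar e), arcStar_mul_vert] at h2
        exact x.trans (x.symm h2) h1
      · have h2 := x.mul (x.mul (x.refl (Γ.arcStar e)) h1) (x.refl (Γ.arc e))
        rwa [arcStar_mul_vert, arcStar_mul_arc, mul_assoc (Γ.arc e), ← mul_assoc (Γ.arcStar e),
          arcStar_mul_arc, mul_assoc, mul_assoc, arcStar_mul_arc, hm', hm] at h2

/-- Since p p* fixes p q* on the left and p p* a = p p*, the relation p q* ≡ a gives p p* ≡ a;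
similarly q q* ≡ a. -/
theorem tight_of_cong_vert {x : Con Γ.InvSemigroup} {a b c d : V} {p q : List E}
    (hp : Γ.IsPath b p d) (hq : Γ.IsPath c q d) (h : x (Γ.pathMulStar p q d) (Γ.vert a))
    (ha : ¬ x (Γ.vert a) 0) : a = b ∧ a = c ∧ Tight x p ∧ Tight x q := by
  have hb : a = b := by
    by_contra hne
    have := x.mul (x.refl (Γ.vert a)) h
    rw [vert_mul_self, pathMulStar, ← hp.vert_mul_path, ← mul_assoc, ← mul_assoc, vert_mul_ne hne,
      zero_mul, zero_mul] at this
    exact ha (x.symm this)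
  have hc : a = c := by
    by_contra hne
    have := x.mul h (x.refl (Γ.vert a))
    rw [vert_mul_self, pathMulStar, ← hq.pathStar_mul_vert, mul_assoc, mul_assoc,
      vert_mul_ne (Ne.symm hne), mul_zero, mul_zero] at this
    exact ha (x.symm this)
  subst hb
  subst hc
  refine ⟨rfl, rfl, ?_, ?_⟩
  · rw [hp.tight_iff]
    have := x.mul (x.refl (Γ.pathMulStar p p d)) h
    rw [pathMulStar, pathMulStar, mul_assoc, ← mul_assoc (Γ.pathStar p d), hp.pathStar_mul_path,
      vert_mul_pathStar, mul_assoc (Γ.path p d), hp.pathStar_mul_vert] at this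
    exact x.trans (x.symm this) h
  · rw [hq.tight_iff]
    have := x.mul h (x.refl (Γ.pathMulStar q q d))
    rw [pathMulStar, pathMulStar, mul_assoc, ← mul_assoc (Γ.pathStar q d), hq.pathStar_mul_path,
      vert_mul_pathStar, ← mul_assoc (Γ.vert _), hq.vert_mul_path] at this
    exact x.trans (x.symm this) h

/-- For incomparable paths l l* m m* = 0, whereas tightness makes this product congruent to a. -/
theorem Tight.comparable {x : Con Γ.InvSemigroup} {a b c : V} {l m : List E} (ha : ¬ x (Γ.vert a) 0)
    (hl : Γ.IsPath a l b) (hm : Γ.IsPath a m c) (hxl : Tight x l) (hxm : Tight x m) :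
    (∃ k, m = l ++ k ∧ Γ.IsPath b k c) ∨ ∃ k, l = m ++ k ∧ Γ.IsPath c k b := by
  rcases hl.comparable hm with h0 | ⟨_, h⟩
  · refine absurd ?_ ha
    have := x.mul (hl.tight_iff.1 hxl) (hm.tight_iff.1 hxm)
    rw [vert_mul_self, pathMulStar, pathMulStar, mul_assoc, ← mul_assoc (Γ.pathStar l b), h0,
      zero_mul, mul_zero] at this
    exact x.symm this
  · exact h

theorem Tight.comparable_of_length_le {x : Con Γ.InvSemigroup} {a b c : V} {l m : List E}
    (ha : ¬ x (Γ.vert a) 0) (hl : Γ.IsPath a l b) (hm : Γ.IsPath a m c) (hxl : Tight x l)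
    (hxm : Tight x m) (hlm : l.length ≤ m.length) : ∃ k, m = l ++ k ∧ Γ.IsPath b k c := by
  rcases Tight.comparable ha hl hm hxl hxm with h | ⟨k, rfl, hk⟩
  · exact h
  · have : k = [] := by
      rw [List.length_append] at hlm
      exact List.length_eq_zero_iff.1 (by omega)
    subst this
    obtain rfl := hk.eq_of_nil
    exact ⟨[], by simp, .nil _⟩

theorem IsPath.tight_of_cong {x : Con Γ.InvSemigroup} {a : V} {l : List E} (h : Γ.IsPath a l a)
    (hx : x (Γ.path l a) (Γ.vert a)) : Tight x l := by
  have h1 := x.mul (x.refl (Γ.pathStar l a)) hx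
  rw [h.pathStar_mul_path, h.pathStar_mul_vert] at h1
  have h2 := x.mul hx (x.symm h1)
  rw [vert_mul_self] at h2
  exact h.tight_iff.2 h2

/-- The ways in which `p q*` and `s t*` (with ranges `a` and `b`) can be congruent without being
congruent to zero, up to exchanging the two. -/
def Linked (x : Con Γ.InvSemigroup) (p q : List E) (a : V) (s t : List E) (b : V) : Prop :=
  (∃ s' t' c, s = p ++ s' ∧ t = q ++ t' ∧ Γ.IsPath a s' b ∧ Γ.IsPath a t' b ∧ Tight x s' ∧
    Tight x t' ∧ (s' = t' ++ c ∨ t' = s' ++ c) ∧ Γ.IsPath b c b ∧ x (Γ.path c b) (Γ.vert b)) ∨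
  ∃ s' q', s = p ++ s' ∧ q = t ++ q' ∧ Γ.IsPath a s' b ∧ Γ.IsPath b q' a ∧ Tight x q' ∧
    x (Γ.path (s' ++ q') a) (Γ.vert a)

/-- Cancelling p on the left and q* on the right leaves a ≡ s t*, so s and t are tight, hence
comparable; the excess of one over the other is a trivial closed path. -/
theorem linked_of_cong_nested {x : Con Γ.InvSemigroup} {p q s t : List E} {a b a₁ a₂ : V}
    (hp : Γ.IsPath a₁ p a) (hq : Γ.IsPath a₂ q a)
    (hs : Γ.IsPath a s b) (ht : Γ.IsPath a t b)
    (h : x (Γ.pathMulStar p q a) (Γ.pathMulStar (p ++ s) (q ++ t) b)) (ha : ¬ x (Γ.vert a) 0) :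
    Linked x p q a (p ++ s) (q ++ t) b := by
  have h1 : x (Γ.vert a) (Γ.pathMulStar s t b) := by
    have := x.mul (x.mul (x.refl (Γ.pathStar p a)) h) (x.refl (Γ.path q a))
    rwa [pathMulStar, pathMulStar, ← mul_assoc, hp.pathStar_mul_path, vert_mul_pathStar,
      hq.pathStar_mul_path, ← mul_assoc, hp.pathStar_mul_path_append hs, mul_assoc,
      hq.pathStar_append_mul_path ht] at this
  obtain ⟨-, -, hxs, hxt⟩ := tight_of_cong_vert hs ht (x.symm h1) ha
  left
  rcases Tight.comparable ha ht hs hxt hxs with ⟨c, rfl, hc⟩ | ⟨c, rfl, hc⟩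
  · refine ⟨_, _, c, rfl, rfl, hs, ht, hxs, hxt, .inl rfl, hc, ?_⟩
    have := x.mul (x.mul (x.refl (Γ.pathStar t b)) h1) (x.refl (Γ.path t b))
    rw [ht.pathStar_mul_vert, ht.pathStar_mul_path, pathMulStar, ← mul_assoc,
      ht.pathStar_mul_path_append hc, mul_assoc, ht.pathStar_mul_path, path_mul_vert] at this
    exact x.symm this
  · refine ⟨_, _, c, rfl, rfl, hs, ht, hxs, hxt, .inr rfl, hc, ?_⟩
    have := x.mul (x.mul (x.refl (Γ.pathStar s b)) h1) (x.refl (Γ.path s b))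
    rw [hs.pathStar_mul_vert, hs.pathStar_mul_path, pathMulStar, ← mul_assoc,
      hs.pathStar_mul_path, mul_assoc, hs.pathStar_append_mul_path hc,
      vert_mul_pathStar] at this
    have h2 := x.mul this (x.refl (Γ.path c b))
    rwa [hc.vert_mul_path, hc.pathStar_mul_path] at h2

/-- Cancelling p on the left and t* on the right leaves q* ≡ s, hence s q ≡ a. -/
theorem linked_of_cong_crossed {x : Con Γ.InvSemigroup} {p q s t : List E} {a b a₁ a₂ : V}
    (hp : Γ.IsPath a₁ p a) (ht : Γ.IsPath a₂ t b)
    (hs : Γ.IsPath a s b) (hq : Γ.IsPath b q a)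
    (h : x (Γ.pathMulStar p (t ++ q) a) (Γ.pathMulStar (p ++ s) t b)) :
    Linked x p (t ++ q) a (p ++ s) t b := by
  have h1 : x (Γ.pathStar q a) (Γ.path s b) := by
    have := x.mul (x.mul (x.refl (Γ.pathStar p a)) h) (x.refl (Γ.path t b))
    rwa [pathMulStar, pathMulStar, ← mul_assoc, hp.pathStar_mul_path, mul_assoc,
      ht.pathStar_append_mul_path hq, vert_mul_pathStar, ← mul_assoc,
      hp.pathStar_mul_path_append hs, mul_assoc, ht.pathStar_mul_path, path_mul_vert] at this
  have h2 : x (Γ.path (s ++ q) a) (Γ.vert a) := by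
    have := x.mul h1 (x.refl (Γ.path q a))
    rw [hq.pathStar_mul_path, hq.path_mul_path] at this
    exact x.symm this
  have h3 := (hs.append hq).tight_of_cong h2
  exact .inr ⟨s, q, rfl, rfl, hs, hq, (tight_append.1 h3).2, h2⟩

theorem linked_of_cong {x : Con Γ.InvSemigroup} {p q s t : List E} {a b a₁ a₂ b₁ b₂ : V}
    (hp : Γ.IsPath a₁ p a) (hq : Γ.IsPath a₂ q a) (hs : Γ.IsPath b₁ s b) (ht : Γ.IsPath b₂ t b)
    (h : x (Γ.pathMulStar p q a) (Γ.pathMulStar s t b)) (ha : ¬ x (Γ.vert a) 0) :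
    Linked x p q a s t b ∨ Linked x s t b p q a := by
  have hb : ¬ x (Γ.vert b) 0 := fun hb =>
    ha (cong_vert_zero hp hq (x.trans h (cong_pathMulStar_zero s t hb)))
  have h1 := x.mul (x.mul (x.refl (Γ.pathStar p a)) h) (x.refl (Γ.path q a))
  rw [pathMulStar, pathMulStar, ← mul_assoc, hp.pathStar_mul_path, vert_mul_pathStar,
    hq.pathStar_mul_path, ← mul_assoc, mul_assoc] at h1
  have h2 := x.mul (x.mul (x.refl (Γ.pathStar s b)) h) (x.refl (Γ.path t b))
  rw [pathMulStar, pathMulStar, ← mul_assoc, ← mul_assoc, hs.pathStar_mul_path, vert_mul_pathStar,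
    ht.pathStar_mul_path, mul_assoc] at h2
  rcases hp.comparable hs with h0 | ⟨rfl, hps⟩
  · rw [h0, zero_mul] at h1
    exact absurd h1 ha
  rcases hq.comparable ht with h0 | ⟨rfl, hqt⟩
  · rw [h0, mul_zero] at h2
    exact absurd (x.symm h2) hb
  rcases hps with ⟨s, rfl, hps⟩ | ⟨p, rfl, hps⟩ <;> rcases hqt with ⟨t, rfl, hqt⟩ | ⟨q, rfl, hqt⟩
  · exact .inl (linked_of_cong_nested hp hq hps hqt h ha)
  · exact .inl (linked_of_cong_crossed hp ht hps hqt h)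
  · exact .inr (linked_of_cong_crossed hs hq hps hqt (x.symm h))
  · exact .inr (linked_of_cong_nested hs ht hps hqt (x.symm h) hb)

/-! ### Comparing congruences -/

/-- Every basic pair related by `x`, namely a vertex and zero, `e e*` and `s(e)` for an edge `e`, or
a closed path and its base vertex, is related by `y`. -/
structure Covers (x y : Con Γ.InvSemigroup) : Prop where
  zero : ∀ a, x (Γ.vert a) 0 → y (Γ.vert a) 0
  edge : ∀ e, x (Γ.arc e * Γ.arcStar e) (Γ.vert (Γ.s e)) →
    y (Γ.arc e * Γ.arcStar e) (Γ.vert (Γ.s e))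
  closed : ∀ a l, Γ.IsPath a l a → x (Γ.path l a) (Γ.vert a) → y (Γ.path l a) (Γ.vert a)

theorem Covers.tight {x y : Con Γ.InvSemigroup} (h : Covers x y) {l : List E} (hl : Tight x l) :
    Tight y l := fun e he => h.edge e (hl e he)

theorem Covers.cong_of_linked {x y : Con Γ.InvSemigroup} (h : Covers x y) {p q s t : List E}
    {a b : V} (hl : Linked x p q a s t b) :
    y (Γ.pathMulStar p q a) (Γ.pathMulStar s t b) := by
  rcases hl with ⟨s, t, c, rfl, rfl, hs, ht, hxs, hxt, hc, hcb, hxc⟩ |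
    ⟨s, q, rfl, rfl, hs, hq, hxq, hx⟩
  · have hyc := h.closed _ _ hcb hxc
    suffices hst : y (Γ.pathMulStar s t b) (Γ.vert a) by
      have := y.mul (y.mul (y.refl (Γ.path p a)) hst) (y.refl (Γ.pathStar q a))
      rw [path_mul_vert, pathMulStar, ← mul_assoc, hs.path_mul_path, mul_assoc,
        ht.pathStar_mul_pathStar] at this
      exact y.symm this
    rcases hc with rfl | rfl
    · refine y.trans ?_ (ht.tight_iff.1 (h.tight hxt))
      have := y.mul (y.mul (y.refl (Γ.path t b)) hyc) (y.refl (Γ.pathStar t b))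
      rwa [hcb.path_mul_path, path_mul_vert] at this
    · refine y.trans ?_ (hs.tight_iff.1 (h.tight hxs))
      have hyc' := y.mul (y.refl (Γ.pathStar c b)) hyc
      rw [hcb.pathStar_mul_path, hcb.pathStar_mul_vert] at hyc'
      have := y.mul (y.mul (y.refl (Γ.path s b)) (y.symm hyc')) (y.refl (Γ.pathStar s b))
      rwa [mul_assoc, hcb.pathStar_mul_pathStar, path_mul_vert] at this
  · have h1 := y.mul (h.closed _ _ (hs.append hq) hx) (y.refl (Γ.pathStar q a))
    rw [vert_mul_pathStar, ← hq.path_mul_path, mul_assoc] at h1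
    have h2 := y.mul (y.refl (Γ.path s b)) (hq.tight_iff.1 (h.tight hxq))
    rw [path_mul_vert] at h2
    have h3 := y.trans (y.symm h1) h2
    have := y.mul (y.mul (y.refl (Γ.path p a)) h3) (y.refl (Γ.pathStar t b))
    rwa [mul_assoc, hq.pathStar_mul_pathStar, hs.path_mul_path] at this

theorem Covers.le {x y : Con Γ.InvSemigroup} (h : Covers x y) : x ≤ y := by
  have hz : ∀ w, x w 0 → y w 0 := by
    intro w hw
    rcases hasNormalForm w with rfl | ⟨p, q, a, b, c, hp, hq, rfl⟩
    · exact y.refl 0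
    · exact cong_pathMulStar_zero p q (h.zero c (cong_vert_zero hp hq hw))
  intro w w' hww
  by_cases hw : x w 0
  · exact y.trans (hz w hw) (y.symm (hz w' (x.trans (x.symm hww) hw)))
  rcases hasNormalForm w with rfl | ⟨p, q, a, b, c, hp, hq, rfl⟩
  · exact absurd (x.refl 0) hw
  rcases hasNormalForm w' with rfl | ⟨s, t, a', b', c', hs, ht, rfl⟩
  · exact absurd hww hw
  rcases linked_of_cong hp hq hs ht hww fun hc => hw (cong_pathMulStar_zero p q hc) with hl | hl
  · exact h.cong_of_linked hl
  · exact y.symm (h.cong_of_linked hl)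

/-! ### Joins of congruences -/

theorem reflTransGen_of_sup {M : Type*} [Mul M] (x y : Con M) {a b : M} (h : (x ⊔ y) a b) :
    Relation.ReflTransGen (fun a b => x a b ∨ y a b) a b := by
  let R : M → M → Prop := fun a b => x a b ∨ y a b
  let c : Con M :=
    { r := Relation.ReflTransGen R
      iseqv :=
        { refl := fun _ => .refl
          symm := fun h => by
            induction h with
            | refl => exact .refl
            | tail _ h ih => exact .head (h.imp x.symm y.symm) ih
          trans := Relation.ReflTransGen.trans }
      mul' := fun {a b c d} h1 h2 => by
        have h3 : Relation.ReflTransGen R (a * c) (b * c) := by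
          induction h1 with
          | refl => exact .refl
          | tail _ h ih =>
            exact .tail ih (h.imp (fun h => x.mul h (x.refl c)) fun h => y.mul h (y.refl c))
        induction h2 with
        | refl => exact h3
        | tail _ h ih => exact .tail ih (h.imp (x.mul (x.refl b)) (y.mul (y.refl b))) }
  have hx : x ≤ c := fun _ _ h => .single (.inl h)
  have hy : y ≤ c := fun _ _ h => .single (.inr h)
  exact sup_le hx hy h

/-- The vertices which are congruent to zero for the join of `x` and `y`. -/
inductive JoinZero (x y : Con Γ.InvSemigroup) : V → Prop
  | left {a : V} (h : x (Γ.vert a) 0) : JoinZero x y a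
  | right {a : V} (h : y (Γ.vert a) 0) : JoinZero x y a
  | step_left (e : E) (h : x (Γ.arc e * Γ.arcStar e) (Γ.vert (Γ.s e)))
      (hr : JoinZero x y (Γ.r e)) : JoinZero x y (Γ.s e)
  | step_right (e : E) (h : y (Γ.arc e * Γ.arcStar e) (Γ.vert (Γ.s e)))
      (hr : JoinZero x y (Γ.r e)) : JoinZero x y (Γ.s e)

theorem JoinZero.swap {x y : Con Γ.InvSemigroup} {a : V} (h : JoinZero x y a) :
    JoinZero y x a := by
  induction h with
  | left h => exact .right h
  | right h => exact .left h
  | step_left e h _ ih => exact .step_right e h ih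
  | step_right e h _ ih => exact .step_left e h ih

/-- Multiply e e* ≡ s(e) by f* on the left and f on the right: f* e = 0 while f* f = r(f). -/
theorem cong_range_zero_of_ne {x : Con Γ.InvSemigroup} {e f : E} (hs : Γ.s f = Γ.s e)
    (hne : f ≠ e) (h : x (Γ.arc e * Γ.arcStar e) (Γ.vert (Γ.s e))) : x (Γ.vert (Γ.r f)) 0 := by
  have := x.mul (x.mul (x.refl (Γ.arcStar f)) h) (x.refl (Γ.arc f))
  rw [← hs, arcStar_mul_vert, arcStar_mul_arc, ← mul_assoc, arcStar_mul_arc_ne hne, zero_mul,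
    zero_mul] at this
  exact x.symm this

theorem cong_edge_zero {x : Con Γ.InvSemigroup} {e : E} (h : x (Γ.vert (Γ.r e)) 0) :
    x (Γ.arc e * Γ.arcStar e) 0 := by
  have := x.mul (x.mul (x.refl (Γ.arc e)) h) (x.refl (Γ.arcStar e))
  rwa [arc_mul_vert, mul_zero, zero_mul] at this

/-- When s(e) is zero through a tight edge f ≠ e, tightness of f already kills r(e). -/
theorem JoinZero.path {x y : Con Γ.InvSemigroup} {a b : V} {l : List E} (h : JoinZero x y a)
    (hl : Γ.IsPath a l b) : JoinZero x y b := by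
  induction hl with
  | nil => exact h
  | cons e _ ih =>
    apply ih
    generalize ha : Γ.s e = a at h
    cases h with
    | left h => exact .left ((ha ▸ IsPath.singleton e).cong_zero h)
    | right h => exact .right ((ha ▸ IsPath.singleton e).cong_zero h)
    | step_left f h hr =>
      by_cases hef : e = f
      · rwa [hef]
      · exact .left (cong_range_zero_of_ne ha hef h)
    | step_right f h hr =>
      by_cases hef : e = f
      · rwa [hef]
      · exact .right (cong_range_zero_of_ne ha hef h)

theorem JoinZero.of_tight {x y : Con Γ.InvSemigroup} {a b : V} {l : List E} (hl : Γ.IsPath a l b)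
    (hx : Tight x l) (hb : JoinZero x y b) : JoinZero x y a := by
  induction hl with
  | nil => exact hb
  | cons e _ ih =>
    rw [tight_cons] at hx
    exact .step_left e hx.1 (ih hx.2 hb)

/-- Invariance of the ideal spanned by the `JoinZero` vertices under one x-step: linked ranges are
joined by a path, or by a tight path traversed backwards. -/
theorem JoinZero.of_cong {x y : Con Γ.InvSemigroup} {w w' : Γ.InvSemigroup} (h : x w w')
    (hw : w = 0 ∨ ∃ s t a b c, Γ.IsPath a s c ∧ Γ.IsPath b t c ∧ w = Γ.pathMulStar s t c ∧
      JoinZero x y c) :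
    w' = 0 ∨ ∃ s t a b c, Γ.IsPath a s c ∧ Γ.IsPath b t c ∧ w' = Γ.pathMulStar s t c ∧
      JoinZero x y c := by
  rcases hasNormalForm w' with rfl | ⟨p, q, a', b', c', hp, hq, rfl⟩
  · exact .inl rfl
  refine .inr ⟨p, q, a', b', c', hp, hq, rfl, ?_⟩
  rcases hw with rfl | ⟨s, t, a, b, c, hs, ht, rfl, hc⟩
  · exact .left (cong_vert_zero hp hq (x.symm h))
  by_cases hc' : x (Γ.vert c') 0
  · exact .left hc'
  rcases linked_of_cong hp hq hs ht (x.symm h) hc' with hl | hl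
  · rcases hl with ⟨s, t, _, rfl, rfl, hs, ht, hxs, hxt, -⟩ | ⟨s, q, rfl, rfl, hs, hq, hxq, hx⟩
    · exact .of_tight hs hxs hc
    · exact hc.path hq
  · rcases hl with ⟨s, t, _, rfl, rfl, hs, ht, hxs, hxt, -⟩ | ⟨s, q, rfl, rfl, hs, hq, hxq, hx⟩
    · exact hc.path hs
    · exact hc.path hs

theorem joinZero_of_sup {x y : Con Γ.InvSemigroup} {a : V} (h : (x ⊔ y) (Γ.vert a) 0) :
    JoinZero x y a := by
  have key : ∀ w, Relation.ReflTransGen (fun a b => x a b ∨ y a b) 0 w →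
      w = 0 ∨ ∃ s t a b c, Γ.IsPath a s c ∧ Γ.IsPath b t c ∧ w = Γ.pathMulStar s t c ∧
        JoinZero x y c := by
    intro w hw
    induction hw with
    | refl => exact .inl rfl
    | tail _ h ih =>
      rcases h with h | h
      · exact JoinZero.of_cong h ih
      · refine (JoinZero.of_cong (y := x) h (ih.imp_right ?_)).imp_right ?_
        all_goals
          rintro ⟨s, t, a, b, c, hs, ht, hw, hc⟩
          exact ⟨s, t, a, b, c, hs, ht, hw, hc.swap⟩
  rcases key _ (reflTransGen_of_sup x y ((x ⊔ y).symm h)) with h0 | ⟨s, t, b, b', c, hs, ht, hw, hc⟩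
  · exact .left (h0 ▸ x.refl 0)
  · by_cases ha : x (Γ.vert a) 0
    · exact .left ha
    -- The equality a = s t*, read as an x-congruence, makes s tight.
    obtain ⟨rfl, -, hxs, -⟩ := tight_of_cong_vert hs ht (hw ▸ x.refl _) ha
    exact .of_tight hs hxs hc

theorem sup_cong_edge {x y : Con Γ.InvSemigroup} {e : E}
    (h : (x ⊔ y) (Γ.arc e * Γ.arcStar e) (Γ.vert (Γ.s e))) (h0 : ¬ (x ⊔ y) (Γ.vert (Γ.s e)) 0) :
    x (Γ.arc e * Γ.arcStar e) (Γ.vert (Γ.s e)) ∨ y (Γ.arc e * Γ.arcStar e) (Γ.vert (Γ.s e)) := by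
  by_contra hne
  rw [not_or] at hne
  -- If e is tight in neither x nor y, the class of s(e) is a singleton in both, hence in the join.
  have step : ∀ z : Con Γ.InvSemigroup, z ≤ x ⊔ y →
      ¬ z (Γ.arc e * Γ.arcStar e) (Γ.vert (Γ.s e)) → ∀ w, z (Γ.vert (Γ.s e)) w →
      w = Γ.vert (Γ.s e) := by
    intro z hz hze w hw
    have hz0 : ¬ z (Γ.vert (Γ.s e)) 0 := fun h => h0 (hz h)
    rcases hasNormalForm w with rfl | ⟨p, q, a, b, c, hp, hq, rfl⟩
    · exact absurd hw hz0
    obtain ⟨ha, hb, hzp, hzq⟩ := tight_of_cong_vert hp hq (z.symm hw) hz0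
    have nil : ∀ {l : List E} {d d' : V}, Γ.IsPath d l d' → Γ.s e = d → Tight z l → l = [] := by
      intro l d d' hl hd hzl
      cases hl with
      | nil => rfl
      | cons f hl =>
        rw [tight_cons] at hzl
        by_cases hfe : e = f
        · subst hfe
          exact absurd hzl.1 hze
        · have h1 := cong_edge_zero (cong_range_zero_of_ne hd hfe hzl.1)
          exact absurd ((x ⊔ y).trans ((x ⊔ y).symm h) (hz h1)) h0
    obtain rfl := nil hp ha hzp
    obtain rfl := nil hq hb hzq
    rw [ha, hp.eq_of_nil]
    exact vert_mul_self c
  have key : ∀ w, Relation.ReflTransGen (fun a b => x a b ∨ y a b) (Γ.vert (Γ.s e)) w →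
      w = Γ.vert (Γ.s e) := by
    intro w hw
    induction hw with
    | refl => rfl
    | tail _ h ih =>
      subst ih
      exact h.elim (step x le_sup_left hne.1 _) (step y le_sup_right hne.2 _)
  have := key _ (reflTransGen_of_sup x y ((x ⊔ y).symm h))
  exact hne.1 (this ▸ x.refl _)

/-! ### Closed paths in joins -/

/-- Some closed path `l` at `a` of length `|n|` satisfies `l ≡ a`. -/
def ClosedLength (x : Con Γ.InvSemigroup) (a : V) (n : ℤ) : Prop :=
  ∃ l, Γ.IsPath a l a ∧ x (Γ.path l a) (Γ.vert a) ∧ ((l.length : ℤ) = n ∨ (l.length : ℤ) = -n)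

theorem ClosedLength.zero (x : Con Γ.InvSemigroup) (a : V) : ClosedLength x a 0 :=
  ⟨[], .nil a, x.refl _, .inl rfl⟩

theorem ClosedLength.neg {x : Con Γ.InvSemigroup} {a : V} {n : ℤ} (h : ClosedLength x a n) :
    ClosedLength x a (-n) := by
  obtain ⟨l, hl, hx, h⟩ := h
  exact ⟨l, hl, hx, by omega⟩

theorem IsPath.cong_append {x : Con Γ.InvSemigroup} {a : V} {l m : List E}
    (hm : Γ.IsPath a m a) (hxl : x (Γ.path l a) (Γ.vert a)) (hxm : x (Γ.path m a) (Γ.vert a)) :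
    x (Γ.path (l ++ m) a) (Γ.vert a) := by
  have := x.mul hxl hxm
  rwa [hm.path_mul_path, vert_mul_self] at this

theorem IsPath.cong_of_append {x : Con Γ.InvSemigroup} {a : V} {l m : List E}
    (hm : Γ.IsPath a m a) (hxl : x (Γ.path l a) (Γ.vert a))
    (hx : x (Γ.path (l ++ m) a) (Γ.vert a)) : x (Γ.path m a) (Γ.vert a) := by
  have := x.mul hxl (x.refl (Γ.path m a))
  rw [hm.path_mul_path, hm.vert_mul_path] at this
  exact x.trans (x.symm this) hx

theorem IsPath.cong_of_append_right {x : Con Γ.InvSemigroup} {a : V} {l m : List E}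
    (hm : Γ.IsPath a m a) (hxm : x (Γ.path m a) (Γ.vert a))
    (hx : x (Γ.path (l ++ m) a) (Γ.vert a)) : x (Γ.path l a) (Γ.vert a) := by
  have := x.mul (x.refl (Γ.path l a)) hxm
  rw [hm.path_mul_path, path_mul_vert] at this
  exact x.trans (x.symm this) hx

/-- Concatenation adds lengths; with opposite signs, one path is a prefix of the other and the
remainder realises the difference. -/
theorem ClosedLength.add {x : Con Γ.InvSemigroup} {a : V} {n m : ℤ} (ha : ¬ x (Γ.vert a) 0)
    (hn : ClosedLength x a n) (hm : ClosedLength x a m) : ClosedLength x a (n + m) := by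
  obtain ⟨l, hl, hxl, hln⟩ := hn
  obtain ⟨k, hk, hxk, hkm⟩ := hm
  by_cases hsame : (l.length : ℤ) + k.length = n + m ∨ (l.length : ℤ) + k.length = -(n + m)
  · refine ⟨l ++ k, hl.append hk, hk.cong_append hxl hxk, ?_⟩
    rw [List.length_append]
    push_cast
    exact hsame
  · rcases Tight.comparable ha hl hk (hl.tight_of_cong hxl) (hk.tight_of_cong hxk) with
      ⟨j, rfl, hj⟩ | ⟨j, rfl, hj⟩
    · refine ⟨j, hj, hj.cong_of_append hxl hxk, ?_⟩
      rw [List.length_append] at hkm hsame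
      push_cast at hkm hsame
      omega
    · refine ⟨j, hj, hj.cong_of_append hxk hxl, ?_⟩
      rw [List.length_append] at hln hsame
      push_cast at hln hsame
      omega

theorem IsPath.exists_closed_length_ge {z : Con Γ.InvSemigroup} {a : V} {c : List E}
    (hc : Γ.IsPath a c a) (hzc : Tight z c) (hne : c ≠ []) (n : ℕ) :
    ∃ l, Γ.IsPath a l a ∧ Tight z l ∧ n ≤ l.length := by
  induction n with
  | zero => exact ⟨[], .nil a, tight_nil z, le_rfl⟩
  | succ n ih =>
    obtain ⟨l, hl, hzl, hn⟩ := ih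
    refine ⟨c ++ l, hc.append hl, tight_append.2 ⟨hzc, hzl⟩, ?_⟩
    have := List.length_pos_iff.2 hne
    rw [List.length_append]
    omega

/-- Trivial closed paths at b are moved to a by conjugating with a tight path q from b to a,
obtained from a long enough power of the cycle c. -/
theorem closedLength_transport {x z : Con Γ.InvSemigroup} (hxz : x ≤ z) {a b : V} {c l p : List E}
    (ha : ¬ z (Γ.vert a) 0) (hc : Γ.IsPath a c a) (hzc : Tight z c) (hne : c ≠ [])
    (hl : Γ.IsPath a l b) (hzl : Tight z l) (hp : Γ.IsPath b p b)
    (hxp : x (Γ.path p b) (Γ.vert b)) : ClosedLength x a p.length := by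
  obtain ⟨d, hd, hzd, hld⟩ := hc.exists_closed_length_ge hzc hne l.length
  obtain ⟨q, rfl, hq⟩ := Tight.comparable_of_length_le ha hl hd hzl hzd hld
  have hzq := (tight_append.1 hzd).2
  have hzp : Tight z p := (hp.tight_of_cong hxp).mono hxz
  have hb : ¬ z (Γ.vert b) 0 := fun hb => ha (hq.cong_zero hb)
  -- Both q and p q are tight from b, so p q = q k, and k ≡ q* p q ≡ a.
  obtain ⟨k, hk, hka⟩ := Tight.comparable_of_length_le hb hq (hp.append hq) hzq
    (tight_append.2 ⟨hzp, hzq⟩) (by rw [List.length_append]; omega)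
  refine ⟨k, hka, ?_, .inl ?_⟩
  · have := x.mul (x.mul (x.refl (Γ.pathStar q a)) hxp) (x.refl (Γ.path q a))
    rwa [hq.pathStar_mul_vert, hq.pathStar_mul_path, mul_assoc, hq.path_mul_path, hk,
      hq.pathStar_mul_path_append hka] at this
  · have := congrArg List.length hk
    rw [List.length_append, List.length_append] at this
    omega

theorem closedLength_of_linked {x z : Con Γ.InvSemigroup} (hxz : x ≤ z) {v a b : V}
    {c p q s t : List E} (hv : ¬ z (Γ.vert v) 0) (hc : Γ.IsPath v c v) (hzc : Tight z c)
    (hne : c ≠ []) (hp : Γ.IsPath v p a) (hs : Γ.IsPath v s b) (hzp : Tight z p) (hzs : Tight z s)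
    (h : Linked x p q a s t b) :
    ClosedLength x v (((s.length : ℤ) - t.length) - ((p.length : ℤ) - q.length)) := by
  rcases h with ⟨s, t, d, rfl, rfl, -, -, -, -, hd, hdb, hx⟩ | ⟨s, q, rfl, rfl, hs', hq, -, hx⟩
  · have h1 := closedLength_transport hxz hv hc hzc hne hs hzs hdb hx
    rcases hd with rfl | rfl
    · convert h1 using 1
      simp only [List.length_append]
      push_cast
      ring
    · convert h1.neg using 1
      simp only [List.length_append]
      push_cast
      ring
  · have h1 := closedLength_transport hxz hv hc hzc hne hp hzp (hs'.append hq) hx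
    convert h1 using 1
    simp only [List.length_append]
    push_cast
    ring

theorem closedLength_of_cong {x z : Con Γ.InvSemigroup} (hxz : x ≤ z) {v a b : V}
    {c p q s t : List E} (hv : ¬ z (Γ.vert v) 0) (hc : Γ.IsPath v c v) (hzc : Tight z c)
    (hne : c ≠ []) (hp : Γ.IsPath v p a) (hq : Γ.IsPath v q a) (hs : Γ.IsPath v s b)
    (ht : Γ.IsPath v t b) (hpq : z (Γ.pathMulStar p q a) (Γ.vert v))
    (h : x (Γ.pathMulStar p q a) (Γ.pathMulStar s t b)) :
    ClosedLength x v (((s.length : ℤ) - t.length) - ((p.length : ℤ) - q.length)) := by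
  have hst := z.trans (z.symm (hxz h)) hpq
  obtain ⟨-, -, hzp, -⟩ := tight_of_cong_vert hp hq hpq hv
  obtain ⟨-, -, hzs, -⟩ := tight_of_cong_vert hs ht hst hv
  have ha : ¬ x (Γ.vert a) 0 := fun ha =>
    hv (z.trans (z.symm hpq) (hxz (cong_pathMulStar_zero p q ha)))
  rcases linked_of_cong hp hq hs ht h ha with hl | hl
  · exact closedLength_of_linked hxz hv hc hzc hne hp hs hzp hzs hl
  · convert (closedLength_of_linked hxz hv hc hzc hne hs hp hzs hzp hl).neg using 1
    ring

/-- Along a chain of x- and y-steps from v, every term is some p q*, and each step changes |p| - |q|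
by a signed length of that congruence. -/
theorem exists_closedLength_of_sup {x y : Con Γ.InvSemigroup} {v : V} {c : List E}
    (hv : ¬ (x ⊔ y) (Γ.vert v) 0) (hc : Γ.IsPath v c v) (hne : c ≠ [])
    (h : (x ⊔ y) (Γ.path c v) (Γ.vert v)) :
    ∃ n m, ClosedLength x v n ∧ ClosedLength y v m ∧ (c.length : ℤ) = n + m := by
  have hzc := hc.tight_of_cong h
  have hvert : Γ.pathMulStar [] [] v = Γ.vert v := vert_mul_self v
  have key : ∀ w, Relation.ReflTransGen (fun a b => x a b ∨ y a b) (Γ.vert v) w →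
      (x ⊔ y) w (Γ.vert v) ∧ ∃ p q a n m, Γ.IsPath v p a ∧ Γ.IsPath v q a ∧
        w = Γ.pathMulStar p q a ∧ ClosedLength x v n ∧ ClosedLength y v m ∧
        (p.length : ℤ) - q.length = n + m := by
    intro w hw
    induction hw with
    | refl => exact ⟨(x ⊔ y).refl _, [], [], v, 0, 0, .nil v, .nil v, hvert.symm, .zero x v,
        .zero y v, rfl⟩
    | @tail w w' _ h ih =>
      obtain ⟨hw, p, q, a, n, m, hp, hq, rfl, hn, hm, hpq⟩ := ih
      have hle : (x ⊔ y) (Γ.pathMulStar p q a) w' :=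
        h.elim (fun h => (le_sup_left : x ≤ x ⊔ y) h) fun h => (le_sup_right : y ≤ x ⊔ y) h
      have hw' := (x ⊔ y).trans ((x ⊔ y).symm hle) hw
      refine ⟨hw', ?_⟩
      rcases hasNormalForm w' with rfl | ⟨s, t, b₁, b₂, b, hs, ht, rfl⟩
      · exact absurd ((x ⊔ y).symm hw') hv
      obtain ⟨rfl, rfl, -⟩ := tight_of_cong_vert hs ht hw' hv
      rcases h with h | h
      · have hk := closedLength_of_cong le_sup_left hv hc hzc hne hp hq hs ht hw h
        exact ⟨s, t, b, _, m, hs, ht, rfl,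
          hn.add (fun h => hv ((le_sup_left : x ≤ x ⊔ y) h)) hk, hm, by omega⟩
      · have hk := closedLength_of_cong le_sup_right hv hc hzc hne hp hq hs ht hw h
        exact ⟨s, t, b, n, _, hs, ht, rfl, hn,
          hm.add (fun h => hv ((le_sup_right : y ≤ x ⊔ y) h)) hk, by omega⟩
  obtain ⟨hw, p, q, a, n, m, hp, hq, hcp, hn, hm, hpq⟩ :=
    key _ (reflTransGen_of_sup x y ((x ⊔ y).symm h))
  have hc' : Γ.pathMulStar c [] v = Γ.path c v := path_mul_vert c v
  -- The chain ends at some p q* equal to c; a last trivial x-step replaces that form by c itself.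
  have hk := closedLength_of_cong (le_sup_left : x ≤ x ⊔ y) hv hc hzc hne hp hq hc (.nil v)
    (hcp ▸ hw) (by rw [hc', hcp]; exact x.refl _)
  refine ⟨_, m, hn.add (fun h => hv ((le_sup_left : x ≤ x ⊔ y) h)) hk, hm, ?_⟩
  rw [List.length_nil]
  push_cast
  omega

/-! ### Modularity -/

theorem JoinZero.sup_inf {x y : Con Γ.InvSemigroup} (z : Con Γ.InvSemigroup) {a : V}
    (h : JoinZero x y a) (hz : z (Γ.vert a) 0) : (x ⊔ y ⊓ z) (Γ.vert a) 0 := by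
  have hx : x ≤ x ⊔ y ⊓ z := le_sup_left
  have hyz : y ⊓ z ≤ x ⊔ y ⊓ z := le_sup_right
  induction h with
  | left h => exact hx h
  | right h => exact hyz ⟨h, hz⟩
  | step_left e h _ ih =>
    have hr := (IsPath.singleton e).cong_zero hz
    exact (x ⊔ y ⊓ z).trans ((x ⊔ y ⊓ z).symm (hx h)) (cong_edge_zero (ih hr))
  | step_right e h _ ih =>
    have hr := (IsPath.singleton e).cong_zero hz
    have hze := z.trans (cong_edge_zero hr) (z.symm hz)
    exact (x ⊔ y ⊓ z).trans ((x ⊔ y ⊓ z).symm (hyz ⟨h, hze⟩)) (cong_edge_zero (ih hr))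

theorem JoinZero.cong_edge (hΓ : ∀ a, ¬ Γ.IsForked a) {x y z : Con Γ.InvSemigroup} (hxz : x ≤ z)
    {e : E} (hz : z (Γ.arc e * Γ.arcStar e) (Γ.vert (Γ.s e))) (hz0 : ¬ z (Γ.vert (Γ.s e)) 0)
    (h : JoinZero x y (Γ.s e)) :
    x (Γ.arc e * Γ.arcStar e) (Γ.vert (Γ.s e)) ∨ y (Γ.arc e * Γ.arcStar e) (Γ.vert (Γ.s e)) := by
  by_cases hy : y (Γ.vert (Γ.s e)) 0
  · exact .inr (y.trans (cong_edge_zero ((IsPath.singleton e).cong_zero hy)) (y.symm hy))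
  have hre : ¬ z (Γ.vert (Γ.r e)) 0 := fun hr => hz0 (z.trans (z.symm hz) (cong_edge_zero hr))
  generalize ha : Γ.s e = a at h
  cases h with
  | left h => exact absurd (hxz (ha ▸ h)) hz0
  | right h => exact absurd (ha ▸ h) hy
  | step_left f h _ =>
    by_cases hef : e = f
    · subst hef
      exact .inl h
    · exact absurd (cong_range_zero_of_ne ha hef (hxz h)) hre
  | step_right f h _ =>
    by_cases hef : e = f
    · subst hef
      exact .inr h
    -- Tightness of e in z kills every other range at s(e) in z, but not r(e); likewise for f in y.
    -- Zero propagates along paths, so e and f witness a fork.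
    · refine absurd ⟨e, f, ha, rfl, hef, fun g hg hge hr => ?_, fun g hg hgf hr => ?_⟩ (hΓ (Γ.s f))
      · obtain ⟨l, hl⟩ := hr.exists_isPath
        exact hre (hl.cong_zero (cong_range_zero_of_ne (hg.trans ha.symm) hge hz))
      · obtain ⟨l, hl⟩ := hr.exists_isPath
        have hf := hl.cong_zero (cong_range_zero_of_ne hg hgf h)
        exact hy (ha ▸ y.trans (y.symm h) (cong_edge_zero hf))

/-- The derivation of zero must follow the cycle, since leaving it by an x-tight edge would make a
zero in z. It ends or leaves the cycle through y, and zero in y travels round the cycle. -/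
theorem JoinZero.zero_of_closed {x y z : Con Γ.InvSemigroup} (hxz : x ≤ z) {a : V}
    (h : JoinZero x y a) : ∀ {c : List E}, Γ.IsPath a c a → c ≠ [] → Tight z c →
    ¬ z (Γ.vert a) 0 → y (Γ.vert a) 0 := by
  induction h with
  | left h => exact fun _ _ _ hz => absurd (hxz h) hz
  | right h => exact fun _ _ _ _ => h
  | step_left e h _ ih =>
    intro c hc hne hzc hz
    obtain _ | ⟨f, c⟩ := c
    · exact absurd rfl hne
    obtain ⟨hf, hc⟩ := hc.of_cons
    rw [tight_cons] at hzc
    by_cases hfe : f = e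
    · subst hfe
      -- Rotate the cycle to start at r(f), then return along its remaining edges.
      refine hc.cong_zero (ih (hc.append (.singleton f)) (by simp) ?_ fun h => hz (hc.cong_zero h))
      exact tight_append.2 ⟨hzc.2, tight_cons.2 ⟨hzc.1, tight_nil z⟩⟩
    · exact absurd (hc.cong_zero (hxz (cong_range_zero_of_ne hf.symm hfe h))) hz
  | step_right e h _ ih =>
    intro c hc hne hzc hz
    obtain _ | ⟨f, c⟩ := c
    · exact absurd rfl hne
    obtain ⟨hf, hc⟩ := hc.of_cons
    rw [tight_cons] at hzc
    by_cases hfe : f = e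
    · subst hfe
      refine hc.cong_zero (ih (hc.append (.singleton f)) (by simp) ?_ fun h => hz (hc.cong_zero h))
      exact tight_append.2 ⟨hzc.2, tight_cons.2 ⟨hzc.1, tight_nil z⟩⟩
    · exact hc.cong_zero (cong_range_zero_of_ne hf.symm hfe h)

theorem sup_inf_cong_closed_of_not_zero {x y z : Con Γ.InvSemigroup} (hxz : x ≤ z) {a : V}
    {c : List E} (hc : Γ.IsPath a c a) (h0 : ¬ (x ⊔ y) (Γ.vert a) 0)
    (hxy : (x ⊔ y) (Γ.path c a) (Γ.vert a)) (hz : z (Γ.path c a) (Γ.vert a)) :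
    (x ⊔ y ⊓ z) (Γ.path c a) (Γ.vert a) := by
  by_cases hne : c = []
  · subst hne
    exact Con.refl _ _
  have hx : x ≤ x ⊔ y ⊓ z := le_sup_left
  have hyz : y ⊓ z ≤ x ⊔ y ⊓ z := le_sup_right
  have hxj : x ≤ x ⊔ y := le_sup_left
  have hyj : y ≤ x ⊔ y := le_sup_right
  obtain ⟨n, m, ⟨p, hp, hxp, hpn⟩, ⟨q, hq, hyq, hqm⟩, hlen⟩ :=
    exists_closedLength_of_sup h0 hc hne hxy
  have hzp := hxz hxp
  have eq_of_length : ∀ {l l' : List E}, Γ.IsPath a l a → Γ.IsPath a l' a →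
      (x ⊔ y) (Γ.path l a) (Γ.vert a) → (x ⊔ y) (Γ.path l' a) (Γ.vert a) →
      l.length = l'.length → l = l' := by
    intro l l' hl hl' hxl hxl' hll
    obtain ⟨k, rfl, -⟩ := Tight.comparable_of_length_le h0 hl hl' (hl.tight_of_cong hxl)
      (hl'.tight_of_cong hxl') hll.le
    rw [List.length_append] at hll
    rw [List.length_eq_zero_iff.1 (by omega : k.length = 0), List.append_nil]
  -- The four sign choices in |c| = ±|p| ± |q|; two minus signs force |c| = 0.
  have hcases : c.length = p.length + q.length ∨ c.length + q.length = p.length ∨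
      c.length + p.length = q.length ∨ c.length = 0 := by omega
  rcases hcases with h | h | h | h
  · obtain rfl := eq_of_length hc (hp.append hq) hxy (hq.cong_append (hxj hxp) (hyj hyq))
      (by rw [List.length_append, h])
    exact hq.cong_append (hx hxp) (hyz ⟨hyq, hq.cong_of_append hzp hz⟩)
  · obtain rfl := eq_of_length (hc.append hq) hp (hq.cong_append hxy (hyj hyq)) (hxj hxp)
      (by rw [List.length_append, h])
    exact hq.cong_of_append_right (hyz ⟨hyq, hq.cong_of_append hz hzp⟩) (hx hxp)
  · obtain rfl := eq_of_length (hc.append hp) hq (hp.cong_append hxy (hxj hxp)) (hyj hyq)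
      (by rw [List.length_append, h])
    exact hp.cong_of_append_right (hx hxp) (hyz ⟨hyq, hp.cong_append hz hzp⟩)
  · exact absurd (List.length_eq_zero_iff.1 h) hne

theorem covers_sup_inf (hΓ : ∀ a, ¬ Γ.IsForked a) {x y z : Con Γ.InvSemigroup} (hxz : x ≤ z) :
    Covers ((x ⊔ y) ⊓ z) (x ⊔ y ⊓ z) := by
  have hx : x ≤ x ⊔ y ⊓ z := le_sup_left
  have hyz : y ⊓ z ≤ x ⊔ y ⊓ z := le_sup_right
  have hzero : ∀ a, (x ⊔ y) (Γ.vert a) 0 → z (Γ.vert a) 0 → (x ⊔ y ⊓ z) (Γ.vert a) 0 :=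
    fun a h hz => (joinZero_of_sup h).sup_inf z hz
  refine ⟨fun a h => hzero a h.1 h.2, fun e ⟨h, hz⟩ => ?_, fun a c hc ⟨h, hz⟩ => ?_⟩
  · have hor : x (Γ.arc e * Γ.arcStar e) (Γ.vert (Γ.s e)) ∨
        y (Γ.arc e * Γ.arcStar e) (Γ.vert (Γ.s e)) →
        (x ⊔ y ⊓ z) (Γ.arc e * Γ.arcStar e) (Γ.vert (Γ.s e)) :=
      fun hor => hor.elim (fun h => hx h) fun h => hyz ⟨h, hz⟩
    by_cases h0 : (x ⊔ y) (Γ.vert (Γ.s e)) 0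
    · by_cases hz0 : z (Γ.vert (Γ.s e)) 0
      · have h1 := hzero _ h0 hz0
        exact Con.trans _ (cong_edge_zero ((IsPath.singleton e).cong_zero h1)) (Con.symm _ h1)
      · exact hor ((joinZero_of_sup h0).cong_edge hΓ hxz hz hz0)
    · exact hor (sup_cong_edge h h0)
  · by_cases h0 : (x ⊔ y) (Γ.vert a) 0
    · by_cases hne : c = []
      · subst hne
        exact Con.refl _ _
      have hpath : ∀ w : Con Γ.InvSemigroup, w (Γ.vert a) 0 → w (Γ.path c a) (Γ.vert a) := by
        intro w hw
        have := w.mul (w.refl (Γ.path c a)) hw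
        rw [path_mul_vert, mul_zero] at this
        exact w.trans this (w.symm hw)
      by_cases hz0 : z (Γ.vert a) 0
      · exact hpath _ (hzero a h0 hz0)
      · have hy := (joinZero_of_sup h0).zero_of_closed hxz hc hne (hc.tight_of_cong hz) hz0
        exact hyz ⟨hpath y hy, hz⟩
    · exact sup_inf_cong_closed_of_not_zero hxz hc h0 h hz

end DirectedGraph

theorem lemma3p4 {V : Type u} {E : Type v} (Γ : DirectedGraph V E)
    (hΓ : ∀ x : V, ¬ Γ.IsForked x) : IsModularLattice Γ.CongruenceLattice :=
  ⟨fun _ _ hxz => (DirectedGraph.covers_sup_inf hΓ hxz).le⟩
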